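/- Let $\mathbb K$ be a field, $n\ge 0$ and $a_1,\dots,a_n\ge 0$ integers, and let $\Delta$ be a simplicial complex on $\{1,\dots,n\}$, that is, a collection of subsets of $\{1,\dots,n\}$ such that $\mathcal J'\subseteq\mathcal J\in\Delta$ implies $\mathcal J'\in\Delta$ (so $\emptyset\in\Delta$ unless $\Delta$ has no members). The facets of $\Delta$ are its inclusion-maximal members. Let $S_\Delta$ be the polynomial ring over $\mathbb K$ with one variable $X_{i_1,\dots,i_n}$ for every $\mathcal J\in\Delta$ and every sequence $(i_1,\dots,i_n)$ with $i_j\in\{1,\dots,a_j\}$ for $j\in\mathcal J$ and $i_j=\bullet$ for $j\notin\mathcal J$. Consider the $\mathbb K$-algebra homomorphisms \begin{itemize} \item $\tau_\Delta\colon S_\Delta\to \mathbb K[x_{c_1,\dots,c_n}\mid 1\le c_j\le a_j]$, which sends $X_{i_1,\dots,i_n}$ to $\sum x_{c_1,\dots,c_n}$, the sum over all $(c_1,\dots,c_n)$ with $c_j=i_j$ whenever $i_j\neq\bullet$; \item $\sigma_\Delta\colon S_\Delta\to\mathbb K[y_{j,i}\mid 1\le j\le n,\ 1\le i\le a_j]$,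 the composite of $\tau_\Delta$ with the Segre map $x_{c_1,\dots,c_n}\mapsto\prod_{j=1}^n y_{j,c_j}$; \item $\eta_\Delta\colon S_\Delta\to\mathbb K[y_{j,i}\mid 1\le j\le n,\ 1\le i\le a_j\text{ or }i=\bullet]$, $X_{i_1,\dots,i_n}\mapsto\prod_{j=1}^n y_{j,i_j}$; \end{itemize} and put $K_\Delta=\ker\tau_\Delta$, $Q_\Delta=\ker\eta_\Delta$, $P_\Delta=\ker\sigma_\Delta$. If $\Delta$ has at most three facets, then the ideal $K_\Delta+Q_\Delta$ of $S_\Delta$ is radical, and $K_\Delta+Q_\Delta=P_\Delta$, which is a prime ideal. -/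

import Mathlib

namespace MarginTables

noncomputable section

open MvPolynomial

/-- The facets (inclusion-maximal faces) of a collection `Δ` of subsets of `Fin n`. -/
def facets {n : ℕ} (Δ : Finset (Finset (Fin n))) : Set (Finset (Fin n)) :=
  {F | Maximal (fun G => G ∈ Δ) F}

/-- The positions at which a multi-index holds a number; `none` is the symbol `•` (or `+`). -/
def support {n : ℕ} {a : Fin n → ℕ} (i : (j : Fin n) → Option (Fin (a j))) : Finset (Fin n) :=
  Finset.univ.filter fun j => (i j).isSome = true

/-- The entries of the `J`-margins of an `a 0 × ⋯ × a (n-1)` table, for all `J ∈ Δ`: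
multi-indices with a number in the positions of some `J ∈ Δ` and `•` in all others. -/
abbrev MarginIndex {n : ℕ} (a : Fin n → ℕ) (Δ : Finset (Finset (Fin n))) : Type :=
  {i : (j : Fin n) → Option (Fin (a j)) // support i ∈ Δ}

/-- The coordinate ring `R = 𝕜[x_{i₁,…,iₙ}]` of all tables. -/
abbrev TableRing (𝕜 : Type*) [Field 𝕜] {n : ℕ} (a : Fin n → ℕ) : Type _ :=
  MvPolynomial ((j : Fin n) → Fin (a j)) 𝕜

/-- The polynomial ring `S_Δ`, with one variable for each entry of each margin in `Δ`. -/
abbrev MarginRing (𝕜 : Type*) [Field 𝕜] {n : ℕ} (a : Fin n → ℕ)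
    (Δ : Finset (Finset (Fin n))) : Type _ :=
  MvPolynomial (MarginIndex a Δ) 𝕜

/-- The marginal sum `x_σ`: the sum of the variables `x_c` over all cells `c` that agree with `σ`
wherever `σ` is a number. -/
def marginSum (𝕜 : Type*) [Field 𝕜] {n : ℕ} {a : Fin n → ℕ}
    (σ : (j : Fin n) → Option (Fin (a j))) : TableRing 𝕜 a :=
  ∑ c : (j : Fin n) → Fin (a j) with (∀ j, σ j = none ∨ σ j = some (c j)), X c

/-- `τ_Δ : S_Δ → R`, turning every `•` into `+`. -/
def tau (𝕜 : Type*) [Field 𝕜] {n : ℕ} (a : Fin n → ℕ) (Δ : Finset (Finset (Fin n))) :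
    MarginRing 𝕜 a Δ →ₐ[𝕜] TableRing 𝕜 a :=
  aeval fun i => marginSum 𝕜 i.1

/-- The Segre map `R → 𝕜[y_{j,i}]`, `x_{i₁,…,iₙ} ↦ ∏ⱼ y_{j,iⱼ}`. -/
def segre (𝕜 : Type*) [Field 𝕜] {n : ℕ} (a : Fin n → ℕ) :
    TableRing 𝕜 a →ₐ[𝕜] MvPolynomial ((j : Fin n) × Fin (a j)) 𝕜 :=
  aeval fun c => ∏ j, X ⟨j, c j⟩

/-- `σ_Δ`, the composite of `τ_Δ` and the Segre map. -/
def sigma (𝕜 : Type*) [Field 𝕜] {n : ℕ} (a : Fin n → ℕ) (Δ : Finset (Finset (Fin n))) :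
    MarginRing 𝕜 a Δ →ₐ[𝕜] MvPolynomial ((j : Fin n) × Fin (a j)) 𝕜 :=
  (segre 𝕜 a).comp (tau 𝕜 a Δ)

/-- The monomial map `η_Δ : S_Δ → 𝕜[y_{j,i}, y_{j,•}]`, `X_{i₁,…,iₙ} ↦ ∏ⱼ y_{j,iⱼ}`. -/
def eta (𝕜 : Type*) [Field 𝕜] {n : ℕ} (a : Fin n → ℕ) (Δ : Finset (Finset (Fin n))) :
    MarginRing 𝕜 a Δ →ₐ[𝕜] MvPolynomial ((j : Fin n) × Option (Fin (a j))) 𝕜 :=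
  aeval fun i => ∏ j, X ⟨j, i.1 j⟩

/-- `K_Δ = ker τ_Δ`. -/
def idealK (𝕜 : Type*) [Field 𝕜] {n : ℕ} (a : Fin n → ℕ) (Δ : Finset (Finset (Fin n))) :
    Ideal (MarginRing 𝕜 a Δ) :=
  RingHom.ker (tau 𝕜 a Δ)

/-- The toric ideal `Q_Δ = ker η_Δ`. -/
def idealQ (𝕜 : Type*) [Field 𝕜] {n : ℕ} (a : Fin n → ℕ) (Δ : Finset (Finset (Fin n))) :
    Ideal (MarginRing 𝕜 a Δ) :=
  RingHom.ker (eta 𝕜 a Δ)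

/-- `P_Δ = ker σ_Δ`. -/
def idealP (𝕜 : Type*) [Field 𝕜] {n : ℕ} (a : Fin n → ℕ) (Δ : Finset (Finset (Fin n))) :
    Ideal (MarginRing 𝕜 a Δ) :=
  RingHom.ker (sigma 𝕜 a Δ)

end

end MarginTables

namespace MarginTables

open MvPolynomial

variable (𝕜 : Type*) [Field 𝕜] {n : ℕ} (a : Fin n → ℕ) (Δ : Finset (Finset (Fin n)))

/-! Since `sigma` factors through both `tau` and `eta`, its kernel contains K and Q; it is prime
because the target is a domain. For the converse, fix a cell `z` and let E = `elimHom` rewrite each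
`z j` as • minus the other indices, multilinearly in the positions. This rewriting is a true
relation among marginal sums, so τ ∘ E = τ and f - E f lies in K. Moreover η ∘ E factors through σ,
so E f lies in Q when f lies in P. Hence f = (f - E f) + E f. -/

/-- The substitution `y_{j,•} ↦ ∑ i, y_{j,i}`. -/
noncomputable def bulletSum :
    MvPolynomial ((j : Fin n) × Option (Fin (a j))) 𝕜 →ₐ[𝕜]
      MvPolynomial ((j : Fin n) × Fin (a j)) 𝕜 :=
  aeval fun p => p.2.elim (∑ i, X ⟨p.1, i⟩) fun i => X ⟨p.1, i⟩

/-- Whether the entry `s` of a multi-index allows the entry `c` of a cell, as a scalar. -/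
def agree {m : ℕ} (s : Option (Fin m)) (c : Fin m) : 𝕜 :=
  if s = none ∨ s = some c then 1 else 0

/-- The coefficients that express an index `s` through `•` and the indices other than `z`,
by means of the relation `z = • - ∑ i ≠ z, i`. -/
def elimCoeff {m : ℕ} (z : Fin m) (s t : Option (Fin m)) : 𝕜 :=
  if s = some z then (if t = none then 1 else if t = some z then 0 else -1)
  else if s = t then 1 else 0

variable {a}

theorem marginSum_eq_sum_prod (s : (j : Fin n) → Option (Fin (a j))) :
    marginSum 𝕜 s = ∑ c : (j : Fin n) → Fin (a j), (∏ j, agree 𝕜 (s j) (c j)) • X c := by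
  classical
  rw [marginSum, Finset.sum_filter]
  refine Finset.sum_congr rfl fun c _ => ?_
  simp only [agree, Finset.prod_ite_zero, Finset.prod_const_one, Finset.mem_univ, true_imp_iff]
  split_ifs <;> simp

/-- A cell entry agrees with • and with exactly one number, so the relation defining `elimCoeff`
holds for agreement indicators. -/
theorem sum_elimCoeff_mul_agree {m : ℕ} (z : Fin m) (s : Option (Fin m)) (c : Fin m) :
    ∑ t, elimCoeff 𝕜 z s t * agree 𝕜 t c = agree 𝕜 s c := by
  by_cases hs : s = some z
  · subst hs
    by_cases hc : c = z <;>
      simp [elimCoeff, agree, Fintype.sum_option, hc, eq_comm (a := z)]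
  · simp [elimCoeff, hs]

theorem elimCoeff_eq_zero {m : ℕ} (z : Fin m) {s t : Option (Fin m)}
    (hs : s.isSome = false) (ht : t.isSome = true) : elimCoeff 𝕜 z s t = 0 := by
  cases s <;> cases t <;> simp_all [elimCoeff]

theorem sigma_eq_bulletSum_comp_eta : sigma 𝕜 a Δ = (bulletSum 𝕜 a).comp (eta 𝕜 a Δ) := by
  classical
  refine MvPolynomial.algHom_ext fun s => ?_
  have key : ∀ j, (s.1 j).elim (∑ i, X ⟨j, i⟩) (fun i => X ⟨j, i⟩) =
      ∑ i, agree 𝕜 (s.1 j) i • (X ⟨j, i⟩ : MvPolynomial ((j : Fin n) × Fin (a j)) 𝕜) := by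
    intro j
    cases s.1 j <;> simp [agree, ite_smul]
  simp only [sigma, tau, eta, bulletSum, AlgHom.comp_apply, aeval_X, map_prod, key,
    marginSum_eq_sum_prod, map_sum, map_smul, segre, Finset.prod_univ_sum,
    Fintype.piFinset_univ]
  refine Finset.sum_congr rfl fun c _ => ?_
  simp only [Algebra.smul_def, Finset.prod_mul_distrib, map_prod]

/-- The endomorphism of `S_Δ` that eliminates the index `z j` in every position `j`. -/
noncomputable def elimHom (z : (j : Fin n) → Fin (a j)) :
    MarginRing 𝕜 a Δ →ₐ[𝕜] MarginRing 𝕜 a Δ :=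
  aeval fun s => ∑ t : MarginIndex a Δ, (∏ j, elimCoeff 𝕜 (z j) (s.1 j) (t.1 j)) • X t

/-- The substitution of `y_{j,•} - ∑ i ≠ z j, y_{j,i}` for `y_{j,z j}`. -/
noncomputable def elimVar (z : (j : Fin n) → Fin (a j)) :
    MvPolynomial ((j : Fin n) × Fin (a j)) 𝕜 →ₐ[𝕜]
      MvPolynomial ((j : Fin n) × Option (Fin (a j))) 𝕜 :=
  aeval fun p => ∑ t, elimCoeff 𝕜 (z p.1) (some p.2) t • X ⟨p.1, t⟩

theorem elimVar_bulletSum_X (z : (j : Fin n) → Fin (a j)) (j : Fin n) (s : Option (Fin (a j))) :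
    elimVar 𝕜 z (bulletSum 𝕜 a (X ⟨j, s⟩)) =
      ∑ t, elimCoeff 𝕜 (z j) s t • (X ⟨j, t⟩ :
        MvPolynomial ((j : Fin n) × Option (Fin (a j))) 𝕜) := by
  classical
  cases s with
  | some i => simp [elimVar, bulletSum]
  | none =>
    simp only [bulletSum, aeval_X, Option.elim, map_sum, elimVar]
    change ∑ i : Fin (a j), ∑ t : Option (Fin (a j)), elimCoeff 𝕜 (z j) (some i) t •
      (X ⟨j, t⟩ : MvPolynomial ((j : Fin n) × Option (Fin (a j))) 𝕜) = _
    rw [Finset.sum_comm]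
    refine Finset.sum_congr rfl fun t _ => ?_
    rw [← Finset.sum_smul]
    congr 1
    -- The row of `z j` is • minus the other indices; adding the rows of those indices cancels all
    -- but •.
    rw [← Finset.add_sum_erase _ _ (Finset.mem_univ (z j))]
    have h : ∀ i ∈ Finset.univ.erase (z j), elimCoeff 𝕜 (z j) (some i) t =
        if some i = t then 1 else 0 := fun i hi => by
      simp [elimCoeff, Finset.ne_of_mem_erase hi]
    rw [Finset.sum_congr rfl h]
    cases t with
    | none => simp [elimCoeff]
    | some k => by_cases hk : k = z j <;> simp [elimCoeff, hk]

variable {Δ}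

/-- Sums of multiples of the elimination coefficients may be taken over all multi-indices. -/
theorem sum_marginIndex_elimCoeff {M : Type*} [AddCommMonoid M] [Module 𝕜 M]
    (hΔ : IsLowerSet (Δ : Set (Finset (Fin n)))) (z : (j : Fin n) → Fin (a j))
    (s : MarginIndex a Δ) (g : ((j : Fin n) → Option (Fin (a j))) → M) :
    ∑ t : MarginIndex a Δ, (∏ j, elimCoeff 𝕜 (z j) (s.1 j) (t.1 j)) • g t.1 =
      ∑ t, (∏ j, elimCoeff 𝕜 (z j) (s.1 j) (t j)) • g t := by
  classical
  rw [← Finset.sum_filter_of_ne (s := Finset.univ) (p := fun t => support t ∈ Δ)]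
  · exact (Finset.sum_subtype _ (by simp)
      fun t => (∏ j, elimCoeff 𝕜 (z j) (s.1 j) (t j)) • g t).symm
  · intro t _ ht
    -- Elimination never turns • into a number, so supports only shrink and stay in the lower set
    -- `Δ`.
    refine hΔ (fun j hj => ?_) s.2
    by_contra hs
    simp only [support, Finset.mem_filter, Finset.mem_univ, true_and, Bool.not_eq_true] at hj hs
    exact ht (by rw [Finset.prod_eq_zero (Finset.mem_univ j)
      (elimCoeff_eq_zero 𝕜 (z j) hs hj), zero_smul])

theorem eta_comp_elimHom (hΔ : IsLowerSet (Δ : Set (Finset (Fin n))))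
    (z : (j : Fin n) → Fin (a j)) :
    (eta 𝕜 a Δ).comp (elimHom 𝕜 Δ z) = (elimVar 𝕜 z).comp (sigma 𝕜 a Δ) := by
  classical
  rw [sigma_eq_bulletSum_comp_eta]
  refine MvPolynomial.algHom_ext fun s => ?_
  simp only [AlgHom.comp_apply, elimHom, eta, aeval_X, map_sum, map_smul, map_prod,
    elimVar_bulletSum_X, Finset.prod_univ_sum, Fintype.piFinset_univ]
  refine (sum_marginIndex_elimCoeff 𝕜 hΔ z s fun t => ∏ j,
    (X ⟨j, t j⟩ : MvPolynomial ((j : Fin n) × Option (Fin (a j))) 𝕜)).trans ?_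
  refine Finset.sum_congr rfl fun t _ => ?_
  simp only [Algebra.smul_def, Finset.prod_mul_distrib, map_prod]

/-- The coefficient of each cell is a product over positions, so the identity reduces to
`sum_elimCoeff_mul_agree` in each position. -/
theorem tau_comp_elimHom (hΔ : IsLowerSet (Δ : Set (Finset (Fin n))))
    (z : (j : Fin n) → Fin (a j)) :
    (tau 𝕜 a Δ).comp (elimHom 𝕜 Δ z) = tau 𝕜 a Δ := by
  classical
  refine MvPolynomial.algHom_ext fun s => ?_
  simp only [AlgHom.comp_apply, elimHom, tau, aeval_X, map_sum, map_smul]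
  rw [sum_marginIndex_elimCoeff 𝕜 hΔ z s fun t => marginSum 𝕜 t]
  simp only [marginSum_eq_sum_prod, Finset.smul_sum, smul_smul, ← Finset.prod_mul_distrib]
  rw [Finset.sum_comm]
  refine Finset.sum_congr rfl fun c _ => ?_
  rw [← Finset.sum_smul]
  congr 1
  simp only [← sum_elimCoeff_mul_agree 𝕜 (z _) (s.1 _), Finset.prod_univ_sum,
    Fintype.piFinset_univ]

variable (Δ)

theorem idealK_le_idealP : idealK 𝕜 a Δ ≤ idealP 𝕜 a Δ := fun f hf => by
  simp only [idealK, idealP, RingHom.mem_ker, sigma, AlgHom.comp_apply] at hf ⊢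
  rw [hf, map_zero]

theorem idealQ_le_idealP : idealQ 𝕜 a Δ ≤ idealP 𝕜 a Δ := fun f hf => by
  simp only [idealQ, idealP, RingHom.mem_ker, sigma_eq_bulletSum_comp_eta,
    AlgHom.comp_apply] at hf ⊢
  rw [hf, map_zero]

variable {Δ}

/-- `P_Δ ⊆ K_Δ + Q_Δ` for every simplicial complex `Δ`. -/
theorem idealP_le_idealK_add_idealQ (hΔ : IsLowerSet (Δ : Set (Finset (Fin n)))) :
    idealP 𝕜 a Δ ≤ idealK 𝕜 a Δ + idealQ 𝕜 a Δ := by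
  intro f hf
  have hf' : sigma 𝕜 a Δ f = 0 := hf
  rw [Submodule.add_eq_sup]
  by_cases h : Nonempty ((j : Fin n) → Fin (a j))
  · obtain ⟨z⟩ := h
    refine Submodule.mem_sup.2 ⟨f - elimHom 𝕜 Δ z f, ?_, elimHom 𝕜 Δ z f, ?_,
      sub_add_cancel _ _⟩
    · have := DFunLike.congr_fun (tau_comp_elimHom 𝕜 hΔ z) f
      rw [AlgHom.comp_apply] at this
      rw [idealK, RingHom.mem_ker, map_sub, this, sub_self]
    · have := DFunLike.congr_fun (eta_comp_elimHom 𝕜 hΔ z) f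
      rw [AlgHom.comp_apply, AlgHom.comp_apply, hf', map_zero] at this
      exact this
  -- Without cells the table ring consists of constants, so the Segre map is injective and P lies in
  -- K.
  · have := not_nonempty_iff.1 h
    refine Submodule.mem_sup_left ?_
    have inj : Function.Injective (segre 𝕜 a) := by
      intro p q hpq
      rw [eq_C_of_isEmpty p, eq_C_of_isEmpty q] at hpq ⊢
      simpa [segre] using hpq
    exact inj (by rw [map_zero]; exact hf')

end MarginTables

theorem mainTheorem4 (𝕜 : Type*) [Field 𝕜] (n : ℕ) (a : Fin n → ℕ)
    (Δ : Finset (Finset (Fin n))) (hΔ : IsLowerSet (Δ : Set (Finset (Fin n))))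
    (hfacets : (MarginTables.facets Δ).ncard ≤ 3) :
    (MarginTables.idealK 𝕜 a Δ + MarginTables.idealQ 𝕜 a Δ).IsRadical ∧
      MarginTables.idealK 𝕜 a Δ + MarginTables.idealQ 𝕜 a Δ = MarginTables.idealP 𝕜 a Δ ∧
      (MarginTables.idealP 𝕜 a Δ).IsPrime := by
  have hprime : (MarginTables.idealP 𝕜 a Δ).IsPrime := RingHom.ker_isPrime _
  have heq : MarginTables.idealK 𝕜 a Δ + MarginTables.idealQ 𝕜 a Δ =
      MarginTables.idealP 𝕜 a Δ :=
    le_antisymm (sup_le (MarginTables.idealK_le_idealP 𝕜 Δ) (MarginTables.idealQ_le_idealP 𝕜 Δ))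
      (MarginTables.idealP_le_idealK_add_idealQ 𝕜 hΔ)
  exact ⟨heq ▸ hprime.isRadical, heq, hprime⟩
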